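/- Let $X,Y,Z$ be the Pauli matrices, $\vec\sigma=(X,Y,Z)$, let $\epsilon\ge 0$, $0\le\nu<1$, and let $\hat n=(\epsilon,0,1)/\sqrt{1+\epsilon^2}$. An unknown single-qubit Hamiltonian $H$ is either $Z$ or $\hat n\cdot\vec\sigma$. A single experiment consists of a pure initial state $|\psi_0\rangle$ of $N\ge 1$ qubits, an integer $L\ge 0$, evolution times $t_1,\dots,t_L\ge 0$, field strengths $0\le\nu_1,\dots,\nu_L\le\nu$, single-qubit Hermitian operators $P_1,\dots,P_L$ of operator norm at most $1$ (for instance $P_l=\vec m_l\cdot\vec\sigma$ with unit vectors $\vec m_l$), $N$-qubit unitaries $U_1,\dots,U_{L+1}$, and an $N$-qubit POVM $\{M_i\}_{i=1}^{Q}$. The outcome $i$ occurs with probability $\langle\psi|M_i|\psi\rangle$, where $$|\psi\rangle=U_{L+1}\bigl(e^{-it_L(H+\nu_LP_L)}\otimes I\bigr)U_L\cdots U_2\bigl(e^{-it_1(H+\nu_1P_1)}\otimes I\bigr)U_1|\psi_0\rangle .$$ The evolution time of the experiment is $t_1+\dots+t_L$, and its number of Hamiltonian evolutions is $L$. An adaptive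 strategy is a finite rooted tree $\mathcal T$: at every inner node a single experiment attached to that node is run, its outcome selects the child at which the strategy continues, and the strategy stops at a leaf. Let $p^{(\mathcal T)}_{\epsilon}$ and $p^{(\mathcal T)}_{0}$ be the distributions of the leaf that is reached for $H=\hat n\cdot\vec\sigma$ and for $H=Z$, respectively. The evolution time and the number of Hamiltonian evolutions of a root-to-leaf path are the sums of those of its experiments, and a path with $L$ Hamiltonian evolutions is counted as having $L+1$ discrete control operations. Then for every adaptive strategy $\mathcal T$ in which every root-to-leaf path has at most $L_{\max}+1$ discrete control operations and total evolution time at most $T_{\max}$, $$\mathrm{TV}\bigl(p^{(\mathcal T)}_{\epsilon},p^{(\mathcal T)}_{0}\bigr)\le \epsilon(4\nu+3\epsilon)\,T_{\max}+\frac{\epsilon(2\nu+\epsilon+1)}{1-\nu}\,L_{\max},$$ where $\mathrm{TV}(p,q)=\frac12\sum_\ell|p(\ell)-q(\ell)|$. -/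

import Mathlib

open scoped Matrix Kronecker

namespace QubitLearning

noncomputable section

/-- The Pauli matrix `X`. -/
def pauliX : Matrix (Fin 2) (Fin 2) ℂ := !![0, 1; 1, 0]

/-- The Pauli matrix `Y`. -/
def pauliY : Matrix (Fin 2) (Fin 2) ℂ := !![0, -Complex.I; Complex.I, 0]

/-- The Pauli matrix `Z`. -/
def pauliZ : Matrix (Fin 2) (Fin 2) ℂ := !![1, 0; 0, -1]

/-- `n · σ` with `σ = (X, Y, Z)`. -/
def dotSigma (n : Fin 3 → ℝ) : Matrix (Fin 2) (Fin 2) ℂ :=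
  (n 0 : ℂ) • pauliX + (n 1 : ℂ) • pauliY + (n 2 : ℂ) • pauliZ

/-- Computational basis labels of `1 + m` qubits: the probed qubit and `m` further qubits. -/
abbrev Register (m : ℕ) : Type := Fin 2 × (Fin m → Fin 2)

open scoped Matrix.Norms.L2Operator ComplexOrder in
/-- A single experiment on `N = numAncilla + 1` qubits, in which the unknown single-qubit
Hamiltonian is evolved `numEvol` times. The norm of a matrix is its `ℓ²` operator norm. -/
structure Experiment where
  /-- the number `N - 1` of qubits on which the unknown Hamiltonian does not act -/
  numAncilla : ℕ
  /-- the initial pure state -/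
  initial : EuclideanSpace ℂ (Register numAncilla)
  norm_initial : ‖initial‖ = 1
  /-- the number `L` of evolutions under the unknown Hamiltonian -/
  numEvol : ℕ
  /-- the evolution times -/
  time : Fin numEvol → ℝ
  time_nonneg : ∀ l, 0 ≤ time l
  /-- the strengths of the external field -/
  strength : Fin numEvol → ℝ
  strength_nonneg : ∀ l, 0 ≤ strength l
  /-- the control directions -/
  dir : Fin numEvol → Matrix (Fin 2) (Fin 2) ℂ
  dir_isHermitian : ∀ l, (dir l).IsHermitian
  dir_norm_le : ∀ l, ‖dir l‖ ≤ 1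
  /-- the interleaved `N`-qubit unitaries `U_1, …, U_{L+1}` (indexed from `0`) -/
  gate : Fin (numEvol + 1) → Matrix.unitaryGroup (Register numAncilla) ℂ
  /-- the number of outcomes of the final measurement -/
  numOutcomes : ℕ
  /-- the POVM -/
  povm : Fin numOutcomes → Matrix (Register numAncilla) (Register numAncilla) ℂ
  povm_posSemidef : ∀ i, (povm i).PosSemidef
  povm_sum : ∑ i, povm i = 1

namespace Experiment

/-- The `l`-th evolution `exp (-i t_l (H + ν_l P_l)) ⊗ I` under the Hamiltonian `H`. -/
def evol (E : Experiment) (H : Matrix (Fin 2) (Fin 2) ℂ) (l : Fin E.numEvol) :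
    Matrix (Register E.numAncilla) (Register E.numAncilla) ℂ :=
  NormedSpace.exp ((-(Complex.I * (E.time l : ℂ))) • (H + (E.strength l : ℂ) • E.dir l)) ⊗ₖ
    (1 : Matrix (Fin E.numAncilla → Fin 2) (Fin E.numAncilla → Fin 2) ℂ)

/-- The product `U_{l+1} V_l U_l ⋯ U_2 V_1 U_1` of the gates and of the first `l` evolutions. -/
def partialUnitary (E : Experiment) (H : Matrix (Fin 2) (Fin 2) ℂ) (l : Fin (E.numEvol + 1)) :
    Matrix (Register E.numAncilla) (Register E.numAncilla) ℂ :=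
  Fin.induction (motive := fun _ =>
      Matrix (Register E.numAncilla) (Register E.numAncilla) ℂ)
    (E.gate 0 : Matrix (Register E.numAncilla) (Register E.numAncilla) ℂ)
    (fun k V => (E.gate k.succ : Matrix (Register E.numAncilla) (Register E.numAncilla) ℂ) *
      (E.evol H k * V)) l

/-- The final state of the experiment when the unknown Hamiltonian is `H`. -/
def finalState (E : Experiment) (H : Matrix (Fin 2) (Fin 2) ℂ) : Register E.numAncilla → ℂ :=
  E.partialUnitary H (Fin.last E.numEvol) *ᵥ E.initial.ofLp

/-- The Born probability `⟨ψ| M_i |ψ⟩` of the outcome `i`. -/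
def outcomeProb (E : Experiment) (H : Matrix (Fin 2) (Fin 2) ℂ) (i : Fin E.numOutcomes) : ℝ :=
  (star (E.finalState H) ⬝ᵥ (E.povm i *ᵥ E.finalState H)).re

/-- The evolution time of a single experiment. -/
def totalTime (E : Experiment) : ℝ := ∑ l, E.time l

end Experiment

/-- An adaptive strategy: at an inner node an experiment is run, and its outcome selects the child
at which the strategy continues; at a leaf the strategy stops. -/
inductive Strategy : Type
  | leaf : Strategy
  | node (E : Experiment) (next : Fin E.numOutcomes → Strategy) : Strategy

namespace Strategy

/-- Every field strength that occurs in the strategy is at most `ν`. -/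
def FieldsAtMost (ν : ℝ) : Strategy → Prop
  | leaf => True
  | node E next => (∀ l, E.strength l ≤ ν) ∧ ∀ i, FieldsAtMost ν (next i)

/-- The leaves of the tree; equivalently, the paths from the root to a leaf, or the complete
sequences of measurement outcomes. -/
def Leaf : Strategy → Type
  | leaf => Unit
  | node E next => Σ i : Fin E.numOutcomes, Leaf (next i)

/-- A strategy has finitely many leaves. -/
instance leafFintype : (𝒯 : Strategy) → Fintype 𝒯.Leaf
  | leaf => inferInstanceAs (Fintype Unit)
  | node E next =>
    letI : ∀ i, Fintype (next i).Leaf := fun i => leafFintype (next i)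
    inferInstanceAs (Fintype (Σ i : Fin E.numOutcomes, (next i).Leaf))

/-- The output distribution: the probability of ending at a given leaf when the unknown
Hamiltonian is `H`. -/
def leafProb (H : Matrix (Fin 2) (Fin 2) ℂ) : (𝒯 : Strategy) → 𝒯.Leaf → ℝ
  | leaf, _ => 1
  | node E next, ⟨i, ℓ⟩ => E.outcomeProb H i * leafProb H (next i) ℓ

/-- The total evolution time along the path from the root to a leaf. -/
def pathTime : (𝒯 : Strategy) → 𝒯.Leaf → ℝ
  | leaf, _ => 0
  | node E next, ⟨i, ℓ⟩ => E.totalTime + pathTime (next i) ℓ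

/-- The number of evolutions under the unknown Hamiltonian along the path to a leaf. -/
def pathEvolutions : (𝒯 : Strategy) → 𝒯.Leaf → ℕ
  | leaf, _ => 0
  | node E next, ⟨i, ℓ⟩ => E.numEvol + pathEvolutions (next i) ℓ

/-- The number of discrete control operations along the path to a leaf: `L` evolutions are
preceded, separated and followed by `L + 1` of them. -/
def pathControlOps (𝒯 : Strategy) (ℓ : 𝒯.Leaf) : ℕ := 𝒯.pathEvolutions ℓ + 1

end Strategy

/-- The total variation distance of two distributions on a finite set. -/
def tvDist {α : Type*} [Fintype α] (p q : α → ℝ) : ℝ := (1 / 2) * ∑ a, |p a - q a|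

end

end QubitLearning

/-! Up to a phase, an evolution under a field is a rotation `cos θ - i sin θ (ŵ · σ)`, where `w` is
the Hamiltonian's unit vector plus the field vector and `θ = t‖w‖`. The phase comes from the
identity component of the field and is the same for both Hamiltonians. Such matrices are
quaternions, so their operator distance is a Euclidean distance in `ℝ⁴`. It has two sources: the
angles differ by `t` times the difference of the lengths `‖w‖`, and the axes differ in direction
(`rotation_dist_sq_le`).

The unperturbed vectors have equal length and are at most `ε` apart, so the lengths differ by at
most `2νε`. Since `‖w‖ ≥ 1 - ν`, the directions differ by at most `ε / (1 - ν)`. One evolution thus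
costs at most `2νεt + ε / (1 - ν)` (`norm_evol_sub_le`), which is below the required constants.

These costs add up along a product of unitaries. The distance of the final states bounds the total
variation of the outcomes (`tvDist_povm_le`), and a hybrid argument on the tree makes the costs add
along each path (`Strategy.tvDist_leafProb_le`). -/

namespace QubitLearning

open Complex

/-! ### Pauli algebra and exponentials -/

/-- The exponential of a linear combination of two complementary orthogonal idempotents. -/
theorem exp_smul_add_smul_of_mul_eq_zero {n : Type*} [Fintype n] [DecidableEq n]
    {P Q : Matrix n n ℂ} (hPQ : P * Q = 0) (hQP : Q * P = 0) (hadd : P + Q = 1) (x y : ℂ) :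
    NormedSpace.exp (x • P + y • Q) = Complex.exp x • P + Complex.exp y • Q := by
  have hP : P * P = P := by
    have := congrArg (P * ·) hadd
    simpa [mul_add, hPQ] using this
  have hQ : Q * Q = Q := by
    have := congrArg (Q * ·) hadd
    simpa [mul_add, hQP] using this
  have hpow : ∀ k : ℕ, (x • P + y • Q) ^ k = x ^ k • P + y ^ k • Q := by
    intro k
    induction k with
    | zero => simp [hadd]
    | succ k ih =>
      rw [pow_succ, ih]
      simp [add_mul, mul_add, hP, hQ, hPQ, hQP, smul_smul, pow_succ, mul_comm]
  open scoped Matrix.Norms.L2Operator in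
  have hsum : HasSum (fun k : ℕ => ((k.factorial : ℂ)⁻¹) • (x • P + y • Q) ^ k)
      (NormedSpace.exp (x • P + y • Q)) := NormedSpace.exp_series_hasSum_exp' _
  have hx : HasSum (fun k : ℕ => x ^ k / (k.factorial : ℂ)) (Complex.exp x) := by
    rw [Complex.exp_eq_exp_ℂ]; exact NormedSpace.expSeries_div_hasSum_exp x
  have hy : HasSum (fun k : ℕ => y ^ k / (k.factorial : ℂ)) (Complex.exp y) := by
    rw [Complex.exp_eq_exp_ℂ]; exact NormedSpace.expSeries_div_hasSum_exp y
  refine hsum.unique ?_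
  convert (hx.smul_const P).add (hy.smul_const Q) using 2 with k
  rw [hpow, smul_add, smul_smul, smul_smul, div_eq_inv_mul, div_eq_inv_mul]

theorem dotSigma_add (v w : Fin 3 → ℝ) : dotSigma (v + w) = dotSigma v + dotSigma w := by
  simp only [dotSigma, Pi.add_apply, Complex.ofReal_add]; module

theorem dotSigma_sub (v w : Fin 3 → ℝ) : dotSigma (v - w) = dotSigma v - dotSigma w := by
  simp only [dotSigma, Pi.sub_apply, Complex.ofReal_sub]; module

theorem dotSigma_smul (c : ℝ) (v : Fin 3 → ℝ) : dotSigma (c • v) = (c : ℂ) • dotSigma v := by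
  simp only [dotSigma, Pi.smul_apply, smul_eq_mul, Complex.ofReal_mul]; module

theorem dotSigma_isHermitian (v : Fin 3 → ℝ) : (dotSigma v).IsHermitian := by
  ext i j
  fin_cases i <;> fin_cases j <;> simp [dotSigma, pauliX, pauliY, pauliZ]

theorem dotSigma_mul_self (v : EuclideanSpace ℝ (Fin 3)) :
    dotSigma v.ofLp * dotSigma v.ofLp = ((‖v‖ ^ 2 : ℝ) : ℂ) • 1 := by
  rw [EuclideanSpace.real_norm_sq_eq, Fin.sum_univ_three]
  ext i j
  fin_cases i <;> fin_cases j <;>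
    simp [dotSigma, pauliX, pauliY, pauliZ, Matrix.mul_apply, Fin.sum_univ_two] <;>
    ring_nf <;> simp

/-- The matrix `α - i v · σ`, which is a multiple of an element of `SU(2)`. -/
noncomputable def spinor (α : ℝ) (v : EuclideanSpace ℝ (Fin 3)) : Matrix (Fin 2) (Fin 2) ℂ :=
  (α : ℂ) • 1 - Complex.I • dotSigma v.ofLp

/-- Differences of spinors are again spinors, so the norm of a difference of two rotations can be
computed exactly from `star_spinor_mul_self`. -/
theorem spinor_sub (α β : ℝ) (v w : EuclideanSpace ℝ (Fin 3)) :
    spinor α v - spinor β w = spinor (α - β) (v - w) := by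
  simp only [spinor, WithLp.ofLp_sub, dotSigma_sub, Complex.ofReal_sub]; module

theorem star_spinor_mul_self (α : ℝ) (v : EuclideanSpace ℝ (Fin 3)) :
    star (spinor α v) * spinor α v = ((α ^ 2 + ‖v‖ ^ 2 : ℝ) : ℂ) • 1 := by
  have h : star (spinor α v) = (α : ℂ) • 1 + Complex.I • dotSigma v.ofLp := by
    rw [spinor, star_sub, star_smul, star_smul, Matrix.star_eq_conjTranspose (dotSigma v.ofLp),
      (dotSigma_isHermitian _).eq]
    simp
  rw [h, spinor]
  have := dotSigma_mul_self v
  simp only [add_mul, mul_sub, smul_mul_assoc, mul_smul_comm, one_mul, mul_one, this, smul_smul]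
  push_cast
  match_scalars
  · linear_combination (-(‖v‖ : ℂ) ^ 2) * Complex.I_sq
  · ring

/-- The matrix has eigenvalues `c ± ‖w‖` with spectral projections `(1 ± w · σ / ‖w‖) / 2`; the
scalar part `c` only contributes a phase. -/
theorem exp_dotSigma (t c : ℝ) (w : EuclideanSpace ℝ (Fin 3)) (hw : w ≠ 0) :
    NormedSpace.exp ((-(Complex.I * (t : ℂ))) • ((c : ℂ) • 1 + dotSigma w.ofLp)) =
      Complex.exp ((-(t * c) : ℝ) * Complex.I) •
        spinor (Real.cos (t * ‖w‖)) ((Real.sin (t * ‖w‖) / ‖w‖) • w) := by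
  have hk : (‖w‖ : ℂ) ≠ 0 := by simpa using hw
  set k : ℂ := (‖w‖ : ℂ) with hkdef
  set S := dotSigma w.ofLp with hS
  have hSS : (k⁻¹ • S) * (k⁻¹ • S) = 1 := by
    rw [smul_mul_smul_comm, hS, dotSigma_mul_self, smul_smul]
    push_cast
    rw [← hkdef]
    have : k⁻¹ * k⁻¹ * k ^ 2 = 1 := by field_simp
    rw [this, one_smul]
  set N := k⁻¹ • S with hN
  have hSN : S = k • N := by rw [hN, smul_smul, mul_inv_cancel₀ hk, one_smul]
  set P : Matrix (Fin 2) (Fin 2) ℂ := (1 / 2 : ℂ) • (1 + N) with hP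
  set Q : Matrix (Fin 2) (Fin 2) ℂ := (1 / 2 : ℂ) • (1 - N) with hQ
  have hPQ : P * Q = 0 := by
    rw [hP, hQ, smul_mul_smul_comm, add_mul, mul_sub, mul_sub, hSS]; simp
  have hQP : Q * P = 0 := by
    rw [hP, hQ, smul_mul_smul_comm, sub_mul, mul_add, mul_add, hSS]; simp [add_comm]
  have hadd : P + Q = 1 := by rw [hP, hQ]; module
  have hexp := exp_smul_add_smul_of_mul_eq_zero hPQ hQP hadd
    (-(Complex.I * t) * (c + k)) (-(Complex.I * t) * (c - k))
  have harg : (-(Complex.I * (t : ℂ))) • ((c : ℂ) • 1 + S) =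
      (-(Complex.I * t) * (c + k)) • P + (-(Complex.I * t) * (c - k)) • Q := by
    rw [hP, hQ, hSN]; module
  have e1 : Complex.exp (-(Complex.I * t) * (c + k)) =
      Complex.exp ((-(t * c) : ℝ) * Complex.I) *
        (Complex.cos (t * k) - Complex.sin (t * k) * Complex.I) := by
    have := Complex.exp_mul_I (-(t * k))
    rw [Complex.cos_neg, Complex.sin_neg, neg_mul (Complex.sin _), ← sub_eq_add_neg] at this
    rw [← this, ← Complex.exp_add]
    congr 1; push_cast; ring
  have e2 : Complex.exp (-(Complex.I * t) * (c - k)) =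
      Complex.exp ((-(t * c) : ℝ) * Complex.I) *
        (Complex.cos (t * k) + Complex.sin (t * k) * Complex.I) := by
    rw [← Complex.exp_mul_I, ← Complex.exp_add]
    congr 1; push_cast; ring
  rw [harg, hexp, e1, e2, spinor, WithLp.ofLp_smul, dotSigma_smul, ← hS, hP, hQ]
  push_cast
  rw [← hkdef, hSN]
  have : (Complex.sin (t * k) / k) • (k • N) = Complex.sin (t * k) • N := by
    rw [smul_smul, div_mul_cancel₀ _ hk]
  rw [this]
  module

/-! ### Geometry of the perturbed rotation axes -/

/-- The squared distance of the rotations about `a` and `b` for the same time. -/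
theorem rotation_dist_sq_le {V : Type*} [NormedAddCommGroup V] [InnerProductSpace ℝ V] {κ : ℝ}
    (hκ : 0 < κ) (t : ℝ) (a b : V) (ha : κ ≤ ‖a‖) (hb : κ ≤ ‖b‖) :
    (Real.cos (t * ‖b‖) - Real.cos (t * ‖a‖)) ^ 2 +
        ‖(Real.sin (t * ‖b‖) / ‖b‖) • b - (Real.sin (t * ‖a‖) / ‖a‖) • a‖ ^ 2 ≤
      (t * (‖b‖ - ‖a‖)) ^ 2 + (‖b - a‖ / κ) ^ 2 := by
  have ha0 : 0 < ‖a‖ := hκ.trans_le ha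
  have hb0 : 0 < ‖b‖ := hκ.trans_le hb
  set x := t * ‖b‖ with hx
  set y := t * ‖a‖ with hy
  -- `2 * g` is the squared distance of the normalized vectors. The left side equals `2 - 2 cos (x -
  -- y) + 2 g sin x sin y`, which separates the angle error from the axis error.
  set g := 1 - inner ℝ b a / (‖b‖ * ‖a‖) with hg
  have hexpand : ‖(Real.sin x / ‖b‖) • b - (Real.sin y / ‖a‖) • a‖ ^ 2 =
      Real.sin x ^ 2 + Real.sin y ^ 2 - 2 * (Real.sin x * Real.sin y) * (1 - g) := by
    rw [norm_sub_sq_real, real_inner_smul_left, real_inner_smul_right, norm_smul, norm_smul,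
      Real.norm_eq_abs, Real.norm_eq_abs, mul_pow, mul_pow, sq_abs, sq_abs, hg]
    field_simp
    ring
  have hg0 : 0 ≤ g := by
    rw [hg, sub_nonneg]
    exact div_le_one_of_le₀ (real_inner_le_norm b a) (by positivity)
  have hg1 : 2 * g ≤ (‖b - a‖ / κ) ^ 2 := by
    have h1 : 2 * g ≤ ‖b - a‖ ^ 2 / (‖b‖ * ‖a‖) := by
      rw [norm_sub_sq_real, le_div_iff₀ (by positivity), hg]
      have : 2 * (1 - inner ℝ b a / (‖b‖ * ‖a‖)) * (‖b‖ * ‖a‖) =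
          2 * (‖b‖ * ‖a‖) - 2 * inner ℝ b a := by field_simp
      rw [this]
      nlinarith [sq_nonneg (‖b‖ - ‖a‖)]
    refine h1.trans ?_
    rw [div_pow]
    gcongr
    rw [sq]
    gcongr
  have hsin : Real.sin x * Real.sin y ≤ 1 := by
    nlinarith [Real.sin_sq_le_one x, Real.sin_sq_le_one y, sq_nonneg (Real.sin x - Real.sin y)]
  have hcos : 2 - 2 * (Real.cos x * Real.cos y + Real.sin x * Real.sin y) ≤
      (t * (‖b‖ - ‖a‖)) ^ 2 := by
    have := Real.one_sub_sq_div_two_le_cos (x := x - y)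
    rw [Real.cos_sub, hx, hy, ← mul_sub] at this
    linarith
  rw [hexpand]
  nlinarith [Real.sin_sq_add_cos_sq x, Real.sin_sq_add_cos_sq y,
    mul_le_mul_of_nonneg_right hsin hg0]

-- A column is the image of a standard basis vector.
open scoped Matrix.Norms.L2Operator in
theorem sum_sq_col_le_norm_sq {m n : Type*} [Fintype m] [Fintype n] [DecidableEq n]
    (A : Matrix m n ℂ) (j : n) : ∑ i, ‖A i j‖ ^ 2 ≤ ‖A‖ ^ 2 := by
  have h := Matrix.l2_opNorm_mulVec A (EuclideanSpace.single j (1 : ℂ))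
  rw [PiLp.norm_single, norm_one, mul_one] at h
  have h2 := pow_le_pow_left₀ (norm_nonneg _) h 2
  rw [EuclideanSpace.norm_sq_eq] at h2
  simpa using h2

open scoped Matrix.Norms.L2Operator in
/-- The Pauli decomposition of a Hermitian contraction. -/
theorem exists_eq_smul_one_add_dotSigma {P : Matrix (Fin 2) (Fin 2) ℂ} (hP : P.IsHermitian)
    (hnorm : ‖P‖ ≤ 1) : ∃ (c : ℝ) (v : EuclideanSpace ℝ (Fin 3)),
      ‖v‖ ≤ 1 ∧ P = (c : ℂ) • 1 + dotSigma v.ofLp := by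
  have h00 : (P 0 0).im = 0 := by
    have := congrArg Complex.im (hP.apply 0 0); simp at this; linarith
  have h11 : (P 1 1).im = 0 := by
    have := congrArg Complex.im (hP.apply 1 1); simp at this; linarith
  have hre : (P 0 1).re = (P 1 0).re := by
    have := congrArg Complex.re (hP.apply 0 1); simp at this; linarith
  have him : (P 0 1).im = -(P 1 0).im := by
    have := congrArg Complex.im (hP.apply 0 1); simp at this; linarith
  refine ⟨((P 0 0).re + (P 1 1).re) / 2,
    !₂[(P 1 0).re, (P 1 0).im, ((P 0 0).re - (P 1 1).re) / 2], ?_, ?_⟩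
  · rw [← sq_le_one_iff₀ (norm_nonneg _), EuclideanSpace.real_norm_sq_eq, Fin.sum_univ_three]
    have h0 := sum_sq_col_le_norm_sq P 0
    have h1 := sum_sq_col_le_norm_sq P 1
    have h : ‖P‖ ^ 2 ≤ 1 := pow_le_one₀ (norm_nonneg _) hnorm
    simp only [Fin.sum_univ_two, Complex.sq_norm, Complex.normSq_apply, h00, h11, hre, him]
      at h0 h1
    simp
    -- The average of the two column bounds is `‖v‖ ^ 2` plus the square of half the trace.
    nlinarith [sq_nonneg ((P 0 0).re + (P 1 1).re)]
  · ext i j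
    fin_cases i <;> fin_cases j <;>
      simp [dotSigma, pauliX, pauliY, pauliZ, Complex.ext_iff, h00, h11, hre, him] <;> ring

theorem norm_sq_add_smul_sub {V : Type*} [NormedAddCommGroup V] [InnerProductSpace ℝ V]
    (a b v : V) (s : ℝ) (h : ‖a‖ = ‖b‖) :
    ‖b + s • v‖ ^ 2 - ‖a + s • v‖ ^ 2 = 2 * s * inner ℝ (b - a) v := by
  rw [norm_add_sq_real, norm_add_sq_real, real_inner_smul_right, real_inner_smul_right,
    inner_sub_left, h]
  ring

/-- A weak field changes the lengths of two unit vectors by almost the same amount. -/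
theorem abs_norm_add_smul_sub_norm_le {V : Type*} [NormedAddCommGroup V] [InnerProductSpace ℝ V]
    {a b v : V} {s ν δ : ℝ} (ha : ‖a‖ = 1) (hb : ‖b‖ = 1) (hv : ‖v‖ ≤ 1) (hs : 0 ≤ s)
    (hsν : s ≤ ν) (hδ : ‖b - a‖ ≤ δ) : |‖b + s • v‖ - ‖a + s • v‖| ≤ 2 * ν * δ := by
  have hδ0 : 0 ≤ δ := (norm_nonneg _).trans hδ
  have hsv : ‖s • v‖ ≤ s := by
    rw [norm_smul, Real.norm_of_nonneg hs]; exact mul_le_of_le_one_right hs hv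
  -- For `ν ≥ 1/2` the triangle inequality gives `δ ≤ 2νδ`. For `ν ≤ 1/2` the two lengths sum to at
  -- least `2 - 2ν ≥ 1`, so the difference of the lengths is at most that of their squares.
  rcases le_total (1 / 2) ν with h | h
  · calc _ ≤ ‖(b + s • v) - (a + s • v)‖ := _root_.abs_norm_sub_norm_le _ _
      _ ≤ δ := by rwa [add_sub_add_right_eq_sub]
      _ ≤ 2 * ν * δ := by nlinarith
  · have h1 : 1 ≤ ‖b + s • v‖ + ‖a + s • v‖ := by
      have e1 := norm_sub_le (b + s • v) (s • v)
      have e2 := norm_sub_le (a + s • v) (s • v)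
      rw [add_sub_cancel_right] at e1 e2
      linarith
    have h2 : |inner ℝ (b - a) v| ≤ δ := (abs_real_inner_le_norm _ _).trans <|
      (mul_le_mul hδ hv (norm_nonneg _) hδ0).trans_eq (mul_one δ)
    have h3 := norm_sq_add_smul_sub a b v s (ha.trans hb.symm)
    calc |‖b + s • v‖ - ‖a + s • v‖|
        ≤ |‖b + s • v‖ - ‖a + s • v‖| * (‖b + s • v‖ + ‖a + s • v‖) :=
          le_mul_of_one_le_right (abs_nonneg _) h1
      _ = |‖b + s • v‖ ^ 2 - ‖a + s • v‖ ^ 2| := by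
          rw [sq_sub_sq, abs_mul, mul_comm, abs_of_nonneg (zero_le_one.trans h1)]
      _ = 2 * s * |inner ℝ (b - a) v| := by
          rw [h3, abs_mul, abs_of_nonneg (by positivity)]
      _ ≤ 2 * ν * δ := by
          have hν : 0 ≤ ν := hs.trans hsν
          gcongr

theorem le_norm_add_smul {V : Type*} [NormedAddCommGroup V] [NormedSpace ℝ V]
    {a v : V} {s ν : ℝ} (ha : ‖a‖ = 1) (hv : ‖v‖ ≤ 1) (hs : 0 ≤ s) (hsν : s ≤ ν) :
    1 - ν ≤ ‖a + s • v‖ := by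
  have e := norm_sub_le (a + s • v) (s • v)
  have : ‖s • v‖ ≤ s := by
    rw [norm_smul, Real.norm_of_nonneg hs]; exact mul_le_of_le_one_right hs hv
  rw [add_sub_cancel_right] at e
  linarith

/-! ### Distinguishing two pure states by a measurement -/

/-- The Born weight `⟨x| M |x⟩` of a real combination of two vectors. -/
theorem re_dotProduct_mulVec_combination {n : Type*} [Fintype n] {M : Matrix n n ℂ}
    (hM : M.IsHermitian) (a b : ℝ) (x y : n → ℂ) :
    (star ((a : ℂ) • x + (b : ℂ) • y) ⬝ᵥ (M *ᵥ ((a : ℂ) • x + (b : ℂ) • y))).re =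
      a ^ 2 * (star x ⬝ᵥ (M *ᵥ x)).re + b ^ 2 * (star y ⬝ᵥ (M *ᵥ y)).re +
        2 * (a * b) * (star x ⬝ᵥ (M *ᵥ y)).re := by
  have h : (star y ⬝ᵥ (M *ᵥ x)).re = (star x ⬝ᵥ (M *ᵥ y)).re := by
    have : star y ⬝ᵥ (M *ᵥ x) = star (star x ⬝ᵥ (M *ᵥ y)) := by
      rw [Matrix.star_dotProduct, Matrix.star_mulVec, hM.eq, Matrix.dotProduct_mulVec]
    rw [this]; simp
  simp only [star_add, star_smul, Matrix.mulVec_add, Matrix.mulVec_smul, add_dotProduct,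
    dotProduct_add, smul_dotProduct, dotProduct_smul, smul_eq_mul, Complex.star_def,
    Complex.conj_ofReal, Complex.add_re, Complex.re_ofReal_mul, h]
  ring

theorem sum_re_dotProduct_mulVec {n ι : Type*} [Fintype n] [DecidableEq n] [Fintype ι]
    {M : ι → Matrix n n ℂ} (hsum : ∑ i, M i = 1) (x y : n → ℂ) :
    ∑ i, (star x ⬝ᵥ (M i *ᵥ y)).re = (star x ⬝ᵥ y).re := by
  rw [← Complex.re_sum, ← dotProduct_sum, ← Matrix.sum_mulVec, hsum, Matrix.one_mulVec]

theorem re_star_dotProduct_self {n : Type*} [Fintype n] (x : EuclideanSpace ℂ n) :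
    (star x.ofLp ⬝ᵥ x.ofLp).re = ‖x‖ ^ 2 := by
  rw [EuclideanSpace.norm_sq_eq]
  simp [dotProduct, Complex.sq_norm, Complex.normSq_apply]

open scoped ComplexOrder in
/-- The outcome distributions of a POVM on two pure states differ in total variation by at most
the distance of the state vectors. -/
theorem tvDist_povm_le {n ι : Type*} [Fintype n] [DecidableEq n] [Fintype ι]
    {M : ι → Matrix n n ℂ} (hM : ∀ i, (M i).PosSemidef) (hsum : ∑ i, M i = 1)
    (x y : EuclideanSpace ℂ n) (hx : ‖x‖ = 1) (hy : ‖y‖ = 1) :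
    tvDist (fun i => (star x.ofLp ⬝ᵥ (M i *ᵥ x.ofLp)).re)
      (fun i => (star y.ofLp ⬝ᵥ (M i *ᵥ y.ofLp)).re) ≤ ‖x - y‖ := by
  set p := fun i => (star x.ofLp ⬝ᵥ (M i *ᵥ x.ofLp)).re
  set q := fun i => (star y.ofLp ⬝ᵥ (M i *ᵥ y.ofLp)).re
  set r := fun i => (star x.ofLp ⬝ᵥ (M i *ᵥ y.ofLp)).re
  rcases eq_or_ne x y with rfl | hne
  · simp [tvDist, p, q]
  have hd : 0 < ‖x - y‖ := norm_pos_iff.2 (sub_ne_zero.2 hne)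
  set d := ‖x - y‖
  have hp : ∑ i, p i = 1 := by
    rw [sum_re_dotProduct_mulVec hsum, re_star_dotProduct_self, hx, one_pow]
  have hq : ∑ i, q i = 1 := by
    rw [sum_re_dotProduct_mulVec hsum, re_star_dotProduct_self, hy, one_pow]
  have hr : ∑ i, r i = (star x.ofLp ⬝ᵥ y.ofLp).re := sum_re_dotProduct_mulVec hsum _ _
  have hd2 : d ^ 2 = 2 - 2 * ∑ i, r i := by
    have h := re_dotProduct_mulVec_combination (Matrix.isHermitian_one (n := n) (α := ℂ)) 1 (-1)
      x.ofLp y.ofLp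
    have e : ((1 : ℝ) : ℂ) • x.ofLp + ((-1 : ℝ) : ℂ) • y.ofLp = (x - y).ofLp := by
      simp [sub_eq_add_neg]
    rw [e] at h
    simp only [Matrix.one_mulVec, re_star_dotProduct_self, hx, hy] at h
    rw [hr, h]; ring
  have hpsd : ∀ i (a b : ℝ), 0 ≤ a ^ 2 * p i + b ^ 2 * q i + 2 * (a * b) * r i := fun i a b => by
    rw [← re_dotProduct_mulVec_combination (hM i).1]
    exact (hM i).re_dotProduct_nonneg _
  -- Since `p i - q i = Re ⟨x + y| M i |x - y⟩`, this is a weighted AM-GM inequality: `M i` is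
  -- tested on `(d / 2) (x + y) ± (x - y)`. The weight `d / 2` balances `‖x + y‖ ≤ 2` against `‖x -
  -- y‖ = d`.
  have hpt : ∀ i, 2 * d * |p i - q i| ≤
      d ^ 2 / 2 * (p i + q i + 2 * r i) + 2 * (p i + q i - 2 * r i) := fun i => by
    have h1 := hpsd i (d / 2 + 1) (d / 2 - 1)
    have h2 := hpsd i (d / 2 - 1) (d / 2 + 1)
    rcases abs_cases (p i - q i) with ⟨h, -⟩ | ⟨h, -⟩ <;> rw [h] <;> nlinarith
  have hs := Finset.sum_le_sum fun i (_ : i ∈ Finset.univ) => hpt i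
  simp only [← Finset.mul_sum, Finset.sum_add_distrib, Finset.sum_sub_distrib, hp, hq] at hs
  -- The summed right side is `4 d ^ 2 - d ^ 4 / 2`.
  have h4 : d * (∑ i, |p i - q i|) ≤ d * (2 * d) := by nlinarith [sq_nonneg (d ^ 2)]
  have := le_of_mul_le_mul_left h4 hd
  change 1 / 2 * ∑ i, |p i - q i| ≤ d
  linarith

/-! ### Adaptive strategies -/

theorem Strategy.leafProb_nonneg (H : Matrix (Fin 2) (Fin 2) ℂ) (𝒯 : Strategy) (ℓ : 𝒯.Leaf) :
    0 ≤ 𝒯.leafProb H ℓ := by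
  induction 𝒯 with
  | leaf => exact zero_le_one
  | node E next ih =>
    obtain ⟨i, ℓ⟩ := ℓ
    exact mul_nonneg ((E.povm_posSemidef i).re_dotProduct_nonneg _) (ih i ℓ)

theorem Experiment.outcomeProb_nonneg (E : Experiment) (H : Matrix (Fin 2) (Fin 2) ℂ)
    (i : Fin E.numOutcomes) : 0 ≤ E.outcomeProb H i :=
  (E.povm_posSemidef i).re_dotProduct_nonneg _

theorem Strategy.sum_leaf_node {E : Experiment} {next : Fin E.numOutcomes → Strategy}
    (f : (Strategy.node E next).Leaf → ℝ) : ∑ ℓ, f ℓ = ∑ i, ∑ ℓ : (next i).Leaf, f ⟨i, ℓ⟩ :=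
  letI : ∀ i, Fintype (next i).Leaf := fun i => leafFintype (next i)
  Fintype.sum_sigma _

theorem Strategy.sum_leafProb {H : Matrix (Fin 2) (Fin 2) ℂ}
    (hH : ∀ E : Experiment, ∑ i, E.outcomeProb H i = 1) (𝒯 : Strategy) :
    ∑ ℓ, 𝒯.leafProb H ℓ = 1 := by
  induction 𝒯 with
  | leaf => exact Fintype.sum_unique (fun _ : Unit => (1 : ℝ))
  | node E next ih =>
    rw [Strategy.sum_leaf_node]
    simp only [leafProb, ← Finset.mul_sum, ih, mul_one, hH]

/-- If every experiment distinguishes two Hamiltonians by at most a cost that is linear in its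
evolution time and its number of evolutions, then so does every adaptive strategy. -/
theorem Strategy.tvDist_leafProb_le {H H' : Matrix (Fin 2) (Fin 2) ℂ} {a b ν : ℝ}
    (ha : 0 ≤ a) (hb : 0 ≤ b)
    (hH : ∀ E : Experiment, ∑ i, E.outcomeProb H i = 1)
    (hH' : ∀ E : Experiment, ∑ i, E.outcomeProb H' i = 1)
    (hE : ∀ E : Experiment, (∀ l, E.strength l ≤ ν) →
      tvDist (E.outcomeProb H) (E.outcomeProb H') ≤ a * E.totalTime + b * E.numEvol)
    (𝒯 : Strategy) (hfield : 𝒯.FieldsAtMost ν) {T Λ : ℝ}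
    (hT : ∀ ℓ, 𝒯.pathTime ℓ ≤ T) (hΛ : ∀ ℓ, (𝒯.pathEvolutions ℓ : ℝ) ≤ Λ) :
    tvDist (𝒯.leafProb H) (𝒯.leafProb H') ≤ a * T + b * Λ := by
  induction 𝒯 generalizing T Λ with
  | leaf =>
    have h1 : 0 ≤ T := hT ()
    have h2 : 0 ≤ Λ := by simpa [pathEvolutions] using hΛ ()
    have : tvDist (leaf.leafProb H) (leaf.leafProb H') = 0 := by
      simp [tvDist, leafProb]
    rw [this]; positivity
  | node E next ih =>
    -- Every child inherits the budget left after `E`, whichever outcome occurs.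
    have hnext : ∀ i, tvDist ((next i).leafProb H) ((next i).leafProb H') ≤
        a * (T - E.totalTime) + b * (Λ - E.numEvol) := fun i => by
      refine ih i (hfield.2 i) (fun ℓ => ?_) fun ℓ => ?_
      · have : E.totalTime + (next i).pathTime ℓ ≤ T := hT ⟨i, ℓ⟩
        linarith
      · have : ((E.numEvol + (next i).pathEvolutions ℓ : ℕ) : ℝ) ≤ Λ := hΛ ⟨i, ℓ⟩
        push_cast at this
        linarith
    have hnode := hE E hfield.1
    have hpt : ∀ i, ∑ ℓ : (next i).Leaf,
        |E.outcomeProb H i * (next i).leafProb H ℓ - E.outcomeProb H' i * (next i).leafProb H' ℓ| ≤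
        |E.outcomeProb H i - E.outcomeProb H' i| +
          E.outcomeProb H' i * (2 * (a * (T - E.totalTime) + b * (Λ - E.numEvol))) := fun i => by
      calc _ ≤ ∑ ℓ : (next i).Leaf,
            (|E.outcomeProb H i - E.outcomeProb H' i| * (next i).leafProb H ℓ +
              E.outcomeProb H' i * |(next i).leafProb H ℓ - (next i).leafProb H' ℓ|) := by
            refine Finset.sum_le_sum fun ℓ _ => ?_
            -- Hybrid step: change the Hamiltonian first in the root experiment, then in the
            -- subtree. The subtree errors are later averaged with weights `E.outcomeProb H' i`,
            -- which sum to one.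
            have e : E.outcomeProb H i * (next i).leafProb H ℓ -
                E.outcomeProb H' i * (next i).leafProb H' ℓ =
                (E.outcomeProb H i - E.outcomeProb H' i) * (next i).leafProb H ℓ +
                E.outcomeProb H' i * ((next i).leafProb H ℓ - (next i).leafProb H' ℓ) := by ring
            rw [e]
            refine (abs_add_le _ _).trans_eq ?_
            rw [abs_mul, abs_mul, abs_of_nonneg (leafProb_nonneg H (next i) ℓ),
              abs_of_nonneg (E.outcomeProb_nonneg H' i)]
        _ ≤ _ := by
            rw [Finset.sum_add_distrib, ← Finset.mul_sum, ← Finset.mul_sum, sum_leafProb hH,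
              mul_one]
            have := hnext i
            unfold tvDist at this
            gcongr
            · exact E.outcomeProb_nonneg H' i
            · linarith
    have hs := Finset.sum_le_sum fun i (_ : i ∈ Finset.univ) => hpt i
    rw [Finset.sum_add_distrib, ← Finset.sum_mul, hH', one_mul] at hs
    unfold tvDist at hnode ⊢
    rw [Strategy.sum_leaf_node]
    simp only [leafProb]
    linarith

/-! ### Evolutions and final states of a single experiment -/

section OperatorNorm

open scoped Matrix.Norms.L2Operator

theorem star_spinor_kronecker_one_mul_self {m : Type*} [Fintype m] [DecidableEq m] (α : ℝ)
    (v : EuclideanSpace ℝ (Fin 3)) :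
    star (spinor α v ⊗ₖ (1 : Matrix m m ℂ)) * (spinor α v ⊗ₖ (1 : Matrix m m ℂ)) =
      ((α ^ 2 + ‖v‖ ^ 2 : ℝ) : ℂ) • 1 := by
  rw [Matrix.star_eq_conjTranspose, Matrix.conjTranspose_kronecker, ← Matrix.mul_kronecker_mul,
    ← Matrix.star_eq_conjTranspose, star_spinor_mul_self, Matrix.conjTranspose_one, mul_one,
    Matrix.smul_kronecker, Matrix.one_kronecker_one]

theorem spinor_kronecker_one_sub {m : Type*} [DecidableEq m] (α β : ℝ)
    (v w : EuclideanSpace ℝ (Fin 3)) :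
    spinor α v ⊗ₖ (1 : Matrix m m ℂ) - spinor β w ⊗ₖ (1 : Matrix m m ℂ) =
      spinor (α - β) (v - w) ⊗ₖ 1 := by
  rw [sub_eq_iff_eq_add, ← Matrix.add_kronecker, ← spinor_sub, sub_add_cancel]

/-- By the C*-identity, as `star A * A` is a scalar matrix. The ancilla factor does not change the
norm. -/
theorem norm_spinor_kronecker_one_sq {m : Type*} [Fintype m] [DecidableEq m] [Nonempty m] (α : ℝ)
    (v : EuclideanSpace ℝ (Fin 3)) :
    ‖spinor α v ⊗ₖ (1 : Matrix m m ℂ)‖ ^ 2 = α ^ 2 + ‖v‖ ^ 2 := by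
  rw [sq, ← CStarRing.norm_star_mul_self, star_spinor_kronecker_one_mul_self, norm_smul,
    CStarRing.norm_one, mul_one, Complex.norm_real, Real.norm_of_nonneg (by positivity)]

namespace Experiment

variable (E : Experiment)

/-- The evolution under a field is a phase times a rotation of the Bloch sphere. -/
theorem exists_evol_eq (l : Fin E.numEvol) : ∃ (z : ℂ) (v : EuclideanSpace ℝ (Fin 3)),
    ‖z‖ = 1 ∧ ‖v‖ ≤ 1 ∧ ∀ h : EuclideanSpace ℝ (Fin 3), h + E.strength l • v ≠ 0 →
      E.evol (dotSigma h.ofLp) l =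
        z • (spinor (Real.cos (E.time l * ‖h + E.strength l • v‖))
          ((Real.sin (E.time l * ‖h + E.strength l • v‖) / ‖h + E.strength l • v‖) •
            (h + E.strength l • v)) ⊗ₖ 1) := by
  obtain ⟨c, v, hv, hP⟩ := exists_eq_smul_one_add_dotSigma (E.dir_isHermitian l) (E.dir_norm_le l)
  refine ⟨Complex.exp ((-(E.time l * (E.strength l * c)) : ℝ) * Complex.I), v,
    Complex.norm_exp_ofReal_mul_I _, hv, fun h hne => ?_⟩
  rw [← Matrix.smul_kronecker, ← exp_dotSigma _ _ _ hne, evol, hP]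
  congr 3
  rw [WithLp.ofLp_add, WithLp.ofLp_smul, dotSigma_add, dotSigma_smul]
  push_cast
  module

variable {E}

theorem evol_mem_unitary {H : Matrix (Fin 2) (Fin 2) ℂ} (hH : H.IsHermitian)
    (l : Fin E.numEvol) : E.evol H l ∈ unitary _ := by
  refine Matrix.kronecker_mem_unitary ?_ (one_mem _)
  let _ : NormedAlgebra ℚ (Matrix (Fin 2) (Fin 2) ℂ) := NormedAlgebra.restrictScalars ℚ ℂ _
  refine NormedSpace.exp_mem_unitary_of_mem_skewAdjoint ?_
  rw [skewAdjoint.mem_iff, star_smul, star_add, star_smul, Matrix.star_eq_conjTranspose H, hH.eq,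
    Matrix.star_eq_conjTranspose, (E.dir_isHermitian l).eq]
  simp [add_comm]

theorem norm_evol_sub_le {a b : EuclideanSpace ℝ (Fin 3)} (ha : ‖a‖ = 1) (hb : ‖b‖ = 1)
    {ν δ : ℝ} (hν : ν < 1) (hδ : ‖b - a‖ ≤ δ) {l : Fin E.numEvol} (hs : E.strength l ≤ ν) :
    ‖E.evol (dotSigma b.ofLp) l - E.evol (dotSigma a.ofLp) l‖ ≤
      2 * ν * δ * E.time l + δ / (1 - ν) := by
  obtain ⟨z, v, hz, hv, he⟩ := E.exists_evol_eq l
  have hκ : 0 < 1 - ν := sub_pos.2 hν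
  have ht := E.time_nonneg l
  have hs0 := E.strength_nonneg l
  have hδ0 : 0 ≤ δ := (norm_nonneg _).trans hδ
  have hν0 : 0 ≤ ν := hs0.trans hs
  have hA := le_norm_add_smul ha hv hs0 hs
  have hB := le_norm_add_smul hb hv hs0 hs
  -- The same `z` and `v` serve both Hamiltonians, so the phase factors out of the difference.
  rw [he b (norm_pos_iff.1 (hκ.trans_le hB)), he a (norm_pos_iff.1 (hκ.trans_le hA)), ← smul_sub,
    spinor_kronecker_one_sub, norm_smul, hz, one_mul]
  refine le_of_sq_le_sq ?_ (by positivity)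
  rw [norm_spinor_kronecker_one_sq]
  refine (rotation_dist_sq_le hκ (E.time l) _ _ hA hB).trans ?_
  rw [add_sub_add_right_eq_sub]
  have h1 := abs_norm_add_smul_sub_norm_le ha hb hv hs0 hs hδ
  have h2 : (E.time l * (‖b + E.strength l • v‖ - ‖a + E.strength l • v‖)) ^ 2 ≤
      (2 * ν * δ * E.time l) ^ 2 := by
    rw [← sq_abs, abs_mul, abs_of_nonneg ht, mul_comm]
    gcongr
  have h3 : (‖b - a‖ / (1 - ν)) ^ 2 ≤ (δ / (1 - ν)) ^ 2 := by gcongr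
  -- The cross term that turns the sum of two squares into a bound by the square of the sum.
  have h4 : 0 ≤ 2 * ν * δ * E.time l * (δ / (1 - ν)) := by positivity
  nlinarith

theorem partialUnitary_mem_unitary {H : Matrix (Fin 2) (Fin 2) ℂ}
    (hH : ∀ l, E.evol H l ∈ unitary _) (l : Fin (E.numEvol + 1)) :
    E.partialUnitary H l ∈ unitary _ := by
  induction l using Fin.induction with
  | zero => exact (E.gate 0).2
  | succ k ih => exact mul_mem (E.gate k.succ).2 (mul_mem (hH k) ih)

/-- Telescoping: exchanging one evolution at a time leaves unitary factors on both sides, and these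
preserve the norm. -/
theorem norm_partialUnitary_sub_le {H H' : Matrix (Fin 2) (Fin 2) ℂ}
    (hH : ∀ l, E.evol H l ∈ unitary _) (hH' : ∀ l, E.evol H' l ∈ unitary _) :
    ‖E.partialUnitary H (Fin.last _) - E.partialUnitary H' (Fin.last _)‖ ≤
      ∑ l, ‖E.evol H l - E.evol H' l‖ := by
  have key : ∀ k : Fin (E.numEvol + 1), ‖E.partialUnitary H k - E.partialUnitary H' k‖ ≤
      ∑ l with l.castSucc < k, ‖E.evol H l - E.evol H' l‖ := by
    intro k
    induction k using Fin.induction with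
    | zero => simp [partialUnitary]
    | succ k ih =>
      have e : E.partialUnitary H k.succ - E.partialUnitary H' k.succ =
          (E.gate k.succ : Matrix _ _ ℂ) *
            ((E.evol H k - E.evol H' k) * E.partialUnitary H k.castSucc +
              E.evol H' k *
                (E.partialUnitary H k.castSucc - E.partialUnitary H' k.castSucc)) := by
        change (E.gate k.succ : Matrix _ _ ℂ) * (E.evol H k * E.partialUnitary H k.castSucc) -
          (E.gate k.succ : Matrix _ _ ℂ) * (E.evol H' k * E.partialUnitary H' k.castSucc) = _
        noncomm_ring
      have hset : Finset.univ.filter (fun l : Fin E.numEvol => l.castSucc < k.succ) =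
          insert k (Finset.univ.filter fun l : Fin E.numEvol => l.castSucc < k.castSucc) := by
        ext l
        simp only [Finset.mem_filter, Finset.mem_univ, true_and, Finset.mem_insert, Fin.lt_def,
          Fin.ext_iff, Fin.val_castSucc, Fin.val_succ]
        omega
      rw [e, hset, Finset.sum_insert (by simp), CStarRing.norm_coe_unitary_mul]
      refine (norm_add_le _ _).trans ?_
      rw [CStarRing.norm_mul_mem_unitary _ (partialUnitary_mem_unitary hH _),
        CStarRing.norm_mem_unitary_mul _ (hH' k)]
      gcongr
  refine (key _).trans_eq ?_
  congr 1
  ext l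
  simp [Fin.castSucc_lt_last]

theorem norm_finalState {H : Matrix (Fin 2) (Fin 2) ℂ} (hH : ∀ l, E.evol H l ∈ unitary _) :
    ‖WithLp.toLp 2 (E.finalState H)‖ = 1 := by
  have hU := (partialUnitary_mem_unitary hH (Fin.last _)).1
  rw [Matrix.star_eq_conjTranspose] at hU
  have h : ‖WithLp.toLp 2 (E.finalState H)‖ ^ 2 = 1 := by
    rw [← re_star_dotProduct_self, finalState, Matrix.star_mulVec, Matrix.dotProduct_mulVec,
      Matrix.vecMul_vecMul, hU, Matrix.vecMul_one, re_star_dotProduct_self, E.norm_initial, one_pow]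
  exact (pow_eq_one_iff_of_nonneg (norm_nonneg _) two_ne_zero).1 h

theorem sum_outcomeProb {H : Matrix (Fin 2) (Fin 2) ℂ} (hH : ∀ l, E.evol H l ∈ unitary _) :
    ∑ i, E.outcomeProb H i = 1 := by
  have h := sum_re_dotProduct_mulVec E.povm_sum (E.finalState H) (E.finalState H)
  have h' := re_star_dotProduct_self (WithLp.toLp 2 (E.finalState H))
  rw [norm_finalState hH, one_pow] at h'
  exact h.trans h'

theorem tvDist_outcomeProb_le {H H' : Matrix (Fin 2) (Fin 2) ℂ}
    (hH : ∀ l, E.evol H l ∈ unitary _) (hH' : ∀ l, E.evol H' l ∈ unitary _) :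
    tvDist (E.outcomeProb H) (E.outcomeProb H') ≤ ∑ l, ‖E.evol H l - E.evol H' l‖ := by
  refine (tvDist_povm_le E.povm_posSemidef E.povm_sum (WithLp.toLp 2 (E.finalState H))
    (WithLp.toLp 2 (E.finalState H')) (norm_finalState hH) (norm_finalState hH')).trans ?_
  refine le_trans ?_ (norm_partialUnitary_sub_le hH hH')
  have h := Matrix.l2_opNorm_mulVec
    (E.partialUnitary H (Fin.last _) - E.partialUnitary H' (Fin.last _)) E.initial
  rw [E.norm_initial, mul_one, Matrix.sub_mulVec] at h
  exact h

end Experiment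

end OperatorNorm

/-! ### The two candidate Hamiltonians and the conclusion -/

theorem pauliZ_eq_dotSigma : pauliZ = dotSigma ![0, 0, 1] := by
  simp [dotSigma]

theorem norm_inv_sqrt_smul (ε : ℝ) : ‖!₂[(√(1 + ε ^ 2))⁻¹ * ε, 0, (√(1 + ε ^ 2))⁻¹]‖ = 1 := by
  have h : 0 < 1 + ε ^ 2 := by positivity
  rw [← sq_eq_sq₀ (norm_nonneg _) zero_le_one, EuclideanSpace.real_norm_sq_eq, Fin.sum_univ_three]
  simp only [Matrix.cons_val]
  rw [mul_pow, inv_pow, Real.sq_sqrt h.le]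
  field_simp
  ring

/-- The unit vectors enclose the angle `arctan ε`, and a chord is at most the tangent. With `s = √(1
+ ε ^ 2)` the gap between the squares is `(s - 1) ^ 2 * (s + 2) / s`. -/
theorem norm_inv_sqrt_smul_sub_le {ε : ℝ} (hε : 0 ≤ ε) :
    ‖!₂[(√(1 + ε ^ 2))⁻¹ * ε, 0, (√(1 + ε ^ 2))⁻¹] - !₂[0, 0, 1]‖ ≤ ε := by
  have h : 0 < 1 + ε ^ 2 := by positivity
  refine le_of_sq_le_sq ?_ hε
  have hs : 0 < √(1 + ε ^ 2) := Real.sqrt_pos.2 h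
  have hsq : ε ^ 2 = √(1 + ε ^ 2) ^ 2 - 1 := by rw [Real.sq_sqrt h.le]; ring
  rw [EuclideanSpace.real_norm_sq_eq, Fin.sum_univ_three]
  simp only [PiLp.sub_apply, Matrix.cons_val]
  rw [sub_zero, mul_pow]
  generalize √(1 + ε ^ 2) = s at hs hsq
  rw [hsq]
  have : s ^ 2 - 1 - ((s⁻¹) ^ 2 * (s ^ 2 - 1) + (0 - 0) ^ 2 + (s⁻¹ - 1) ^ 2) =
      (s - 1) ^ 2 * (s + 2) / s := by
    field_simp
    ring
  have h2 : 0 ≤ (s - 1) ^ 2 * (s + 2) / s := by positivity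
  linarith

end QubitLearning

open QubitLearning in
open scoped Matrix.Norms.L2Operator in
theorem corollaryS1 (ε ν Tmax : ℝ) (Lmax : ℕ) (hε : 0 ≤ ε) (hν₀ : 0 ≤ ν) (hν₁ : ν < 1)
    (𝒯 : QubitLearning.Strategy) (hfield : 𝒯.FieldsAtMost ν)
    (hctrl : ∀ ℓ : 𝒯.Leaf, 𝒯.pathControlOps ℓ ≤ Lmax + 1)
    (htime : ∀ ℓ : 𝒯.Leaf, 𝒯.pathTime ℓ ≤ Tmax) :
    QubitLearning.tvDist
        (𝒯.leafProb (QubitLearning.dotSigma ((√(1 + ε ^ 2))⁻¹ • ![ε, 0, 1])))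
        (𝒯.leafProb QubitLearning.pauliZ) ≤
      ε * (4 * ν + 3 * ε) * Tmax + ε * (2 * ν + ε + 1) / (1 - ν) * Lmax := by
  have hκ : 0 < 1 - ν := sub_pos.2 hν₁
  have hn : (√(1 + ε ^ 2))⁻¹ • ![ε, 0, 1] =
      (!₂[(√(1 + ε ^ 2))⁻¹ * ε, 0, (√(1 + ε ^ 2))⁻¹] : EuclideanSpace ℝ (Fin 3)).ofLp := by
    simp
  have hz : ‖(!₂[0, 0, 1] : EuclideanSpace ℝ (Fin 3))‖ = 1 := by
    simpa using norm_inv_sqrt_smul 0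
  have hunit := fun (v : Fin 3 → ℝ) (E : Experiment) (l : Fin E.numEvol) =>
    Experiment.evol_mem_unitary (E := E) (dotSigma_isHermitian v) l
  rw [pauliZ_eq_dotSigma]
  refine Strategy.tvDist_leafProb_le (ν := ν) (by positivity) (by positivity)
    (fun E => Experiment.sum_outcomeProb (hunit _ E))
    (fun E => Experiment.sum_outcomeProb (hunit _ E)) (fun E hE => ?_) 𝒯 hfield htime fun ℓ => ?_
  · refine (Experiment.tvDist_outcomeProb_le (hunit _ E) (hunit _ E)).trans ?_
    have hl : ∀ l, ‖E.evol (dotSigma ((√(1 + ε ^ 2))⁻¹ • ![ε, 0, 1])) l -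
        E.evol (dotSigma ![0, 0, 1]) l‖ ≤
        ε * (4 * ν + 3 * ε) * E.time l + ε * (2 * ν + ε + 1) / (1 - ν) := fun l => by
      rw [hn]
      refine (Experiment.norm_evol_sub_le hz (norm_inv_sqrt_smul ε) hν₁
        (norm_inv_sqrt_smul_sub_le hε) (hE l)).trans ?_
      -- The required constants are weaker: `2νε ≤ ε(4ν + 3ε)` and `ε ≤ ε(2ν + ε + 1)`.
      have ht := E.time_nonneg l
      have h1 := mul_nonneg hε hν₀
      have h2 := mul_nonneg hε hε
      exact add_le_add (mul_le_mul_of_nonneg_right (by linarith) ht)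
        (div_le_div_of_nonneg_right (by linarith) hκ.le)
    refine (Finset.sum_le_sum fun l _ => hl l).trans_eq ?_
    rw [Finset.sum_add_distrib, ← Finset.mul_sum, Finset.sum_const, Finset.card_univ,
      Fintype.card_fin, nsmul_eq_mul, mul_comm (E.numEvol : ℝ)]
    rfl
  -- A path has one more control operation than evolutions, so it has at most `Lmax` evolutions.
  · have := hctrl ℓ
    unfold Strategy.pathControlOps at this
    exact_mod_cast Nat.le_of_succ_le_succ this
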